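/- All topological groups are assumed to be Hausdorff. A topological group $X$ is called - *$\omega$-narrow* if for every neighborhood $U\subset X$ of the unit there is a countable set $C\subset X$ with $X=CU$; - *$\mathsf{h}{:}\mathsf{TG}$-closed* if for every continuous homomorphism $f:X\to Y$ to a (Hausdorff) topological group $Y$ the image $f(X)$ is closed in $Y$; - *complete* if it is complete in its two-sided uniformity, i.e. the uniformity generated by the entourages $\{(x,y)\in X\times X: y\in xU\cap Ux\}$, where $U$ runs over the neighborhoods of the unit; - *minimal* if every continuous bijective homomorphism $f:X\to Y$ to a (Hausdorff) topological group $Y$ is open; - *totally complete* (resp. *totally minimal*) if for every closed normal subgroup $N\subset X$ the quotient topological group $X/N$ is complete (resp. minimal). **Theorem.** Let $X$ be an $\omega$-narrow topological group. Then $X$ is $\mathsf{h}{:}\mathsf{TG}$-closed if and only if $X$ is totally complete and totally minimal. Moreover, if $X$ is $\mathsf{h}{:}\mathsf{TG}$-closed, then $X$ is minimal. -/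

import Mathlib

universe u

open scoped Pointwise Topology

section TopologicalGroups

variable (G : Type u) [Group G] [TopologicalSpace G]

/-- A topological group `G` is ω-narrow if for every neighborhood `U` of the unit there is a
countable set `C` with `G = C * U`. -/
def IsOmegaNarrow : Prop :=
  ∀ U ∈ 𝓝 (1 : G), ∃ C : Set G, C.Countable ∧ C * U = Set.univ

/-- `G` is `h:TG`-closed: for every continuous homomorphism `f` from `G` to a Hausdorff topological
group `Y`, the image of `f` is closed in `Y`. Letting `Y` range over the universe of `G` is no
restriction: whether the image is closed in `Y` can be decided inside its closure, and a point `y`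
of this closure is determined by the filter generated on `G` by the preimages of the
neighborhoods of `y`. -/
def IsHTGClosed : Prop :=
  ∀ (Y : Type u) [Group Y] [TopologicalSpace Y] [IsTopologicalGroup Y] [T2Space Y]
    (f : G →* Y), Continuous f → IsClosed (Set.range f)

/-- `G` is minimal: every continuous bijective homomorphism from `G` onto a Hausdorff topological
group is open (hence a topological isomorphism). -/
def IsMinimalTopGroup : Prop :=
  ∀ (Y : Type u) [Group Y] [TopologicalSpace Y] [IsTopologicalGroup Y] [T2Space Y]
    (f : G →* Y), Continuous f → Function.Bijective f → IsOpenMap f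

variable [IsTopologicalGroup G]

/-- The two-sided uniformity of a topological group: the coarsest uniformity that is finer than the
left and the right uniformity. -/
abbrev twoSidedUniformSpace : UniformSpace G :=
  IsTopologicalGroup.leftUniformSpace G ⊓ IsTopologicalGroup.rightUniformSpace G

/-- The two-sided uniformity is generated by the entourages `{(x, y) | y ∈ xU ∩ Ux}`, where `U`
runs over the neighborhoods of the unit. -/
theorem twoSidedUniformSpace_hasBasis :
    (@uniformity G (twoSidedUniformSpace G)).HasBasis (fun U : Set G => U ∈ 𝓝 1)
      (fun U => {p : G × G | p.2 ∈ ({p.1} * U) ∩ (U * {p.1})}) := by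
  rw [inf_uniformity]
  have hL : @uniformity G (IsTopologicalGroup.leftUniformSpace G) =
      Filter.comap (fun p : G × G => p.1⁻¹ * p.2) (𝓝 1) := rfl
  have hR : @uniformity G (IsTopologicalGroup.rightUniformSpace G) =
      Filter.comap (fun p : G × G => p.2 * p.1⁻¹) (𝓝 1) := rfl
  rw [hL, hR]
  refine ⟨fun t => ?_⟩
  rw [Filter.mem_inf_iff]
  constructor
  · rintro ⟨a, ⟨U, hU, hUa⟩, b, ⟨V, hV, hVb⟩, rfl⟩
    refine ⟨U ∩ V, Filter.inter_mem hU hV, ?_⟩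
    rintro ⟨x, y⟩ ⟨h1, h2⟩
    simp only [Set.singleton_mul, Set.mul_singleton, Set.mem_image] at h1 h2
    obtain ⟨z, hz, rfl⟩ := h1
    obtain ⟨w, hw, hwz⟩ := h2
    refine ⟨hUa (by simpa using hz.1), hVb ?_⟩
    have : x * z * x⁻¹ = w := by rw [← hwz]; simp
    simpa [this] using hw.2
  · rintro ⟨U, hU, hUt⟩
    refine ⟨(fun p : G × G => p.1⁻¹ * p.2) ⁻¹' U ∪ t, ⟨U, hU, Set.subset_union_left⟩,
      (fun p : G × G => p.2 * p.1⁻¹) ⁻¹' U ∪ t, ⟨U, hU, Set.subset_union_left⟩, ?_⟩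
    rw [← Set.inter_union_distrib_right, eq_comm, Set.union_eq_right]
    rintro ⟨x, y⟩ ⟨h1, h2⟩
    refine hUt ⟨?_, ?_⟩
    · exact ⟨x, rfl, x⁻¹ * y, h1, by simp⟩
    · exact ⟨y * x⁻¹, h2, x, rfl, by simp⟩

/-- A topological group is complete if it is complete in its two-sided uniformity. -/
def IsCompleteTopGroup : Prop :=
  @CompleteSpace G (twoSidedUniformSpace G)

/-- Every quotient of `G` by a closed normal subgroup is complete. -/
def IsTotallyComplete : Prop :=
  ∀ (N : Subgroup G) [N.Normal], IsClosed (N : Set G) → IsCompleteTopGroup (G ⧸ N)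

/-- Every quotient of `G` by a closed normal subgroup is minimal. -/
def IsTotallyMinimal : Prop :=
  ∀ (N : Subgroup G) [N.Normal], IsClosed (N : Set G) → IsMinimalTopGroup (G ⧸ N)

end TopologicalGroups

/-! The main tool is `IsHTGClosed.exists_le_nhds`: the image of X in the Raikov completion of a
coarser group topology is dense and closed, so an `h:TG`-closed X is complete in every coarser group
topology, Hausdorff or not. By ω-narrowness each neighborhood of 1 remains one in some coarser group
topology with a countable base at 1 (`IsOmegaNarrow.exists_nested_seq`).

A category argument in such a topology shows that X is Baire, and so is each continuous homomorphic
image Y. A continuous bijective f : X → Y is then almost open. Over a generic point w of Y near 1, a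
branch through a countable tree of open sets of X yields a Cauchy filter whose limit maps to w;
hence f(U) contains a comeager part of a neighborhood of 1, and f is open by Pettis' argument.
Quotients inherit both hypotheses, which gives the total versions. The converse factors a
homomorphism through its kernel. -/

open Filter Set Function

/-! ### Two-sided Cauchy filters and the Raikov completion -/

/-- A filter on a topological group is two-sided Cauchy if it is Cauchy in the two-sided
uniformity. -/
def IsTwoSidedCauchy {G : Type*} [Group G] [TopologicalSpace G] (F : Filter G) : Prop :=
  F.NeBot ∧ ∀ U ∈ 𝓝 (1 : G), ∃ A ∈ F, ∀ x ∈ A, ∀ y ∈ A, x⁻¹ * y ∈ U ∧ y * x⁻¹ ∈ U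

namespace IsTwoSidedCauchy

variable {G : Type*} [Group G] [TopologicalSpace G]

theorem iff_cauchy [IsTopologicalGroup G] {F : Filter G} :
    IsTwoSidedCauchy F ↔ @Cauchy G (twoSidedUniformSpace G) F := by
  let := twoSidedUniformSpace G
  rw [(twoSidedUniformSpace_hasBasis G).cauchy_iff]
  refine and_congr Iff.rfl (forall₂_congr fun U _ => exists_congr fun A => and_congr Iff.rfl
    (forall₂_congr fun x _ => forall₂_congr fun y _ => ?_))
  simp

theorem map_inv {F : Filter G} (hF : IsTwoSidedCauchy F) :
    IsTwoSidedCauchy (F.map (·⁻¹)) := by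
  obtain ⟨hne, hF⟩ := hF
  refine ⟨hne.map _, fun U hU => ?_⟩
  obtain ⟨A, hA, h⟩ := hF U hU
  refine ⟨_, image_mem_map hA, ?_⟩
  rintro _ ⟨x, hx, rfl⟩ _ ⟨y, hy, rfl⟩
  have := h y hy x hx
  simpa using this.symm

variable [IsTopologicalGroup G]

/-- Conjugation is not uniformly continuous, but fixed a ∈ A, b ∈ B suffice: y⁻¹(x⁻¹x')y' =
(y⁻¹b)(b⁻¹x⁻¹x'b)(b⁻¹y'), and symmetrically with a on the other side. -/
theorem map_mul {F F' : Filter G} (hF : IsTwoSidedCauchy F) (hF' : IsTwoSidedCauchy F') :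
    IsTwoSidedCauchy ((F ×ˢ F').map fun p => p.1 * p.2) := by
  obtain ⟨hne, hF⟩ := hF
  obtain ⟨hne', hF'⟩ := hF'
  refine ⟨inferInstance, fun U hU => ?_⟩
  obtain ⟨W, hW, hWU⟩ := exists_nhds_one_split4 hU
  obtain ⟨A, hA, hAW⟩ := hF W hW
  obtain ⟨B, hB, hBW⟩ := hF' W hW
  obtain ⟨a, ha⟩ := Filter.nonempty_of_mem hA
  obtain ⟨b, hb⟩ := Filter.nonempty_of_mem hB
  have key : ∀ g : G, (fun x => g * x * g⁻¹) ⁻¹' W ∈ 𝓝 (1 : G) := fun g =>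
    ContinuousAt.preimage_mem_nhds (by fun_prop) (by simpa using hW)
  obtain ⟨A', hA', hAW'⟩ := hF _ (key b⁻¹)
  obtain ⟨B', hB', hBW'⟩ := hF' _ (key a)
  have h1 : (1 : G) ∈ W := mem_of_mem_nhds hW
  refine ⟨_, image_mem_map (prod_mem_prod (inter_mem hA hA') (inter_mem hB hB')), ?_⟩
  rintro _ ⟨⟨x, y⟩, ⟨⟨hx, hx'⟩, hy, hy'⟩, rfl⟩ _ ⟨⟨x', y'⟩, ⟨⟨hz, hz'⟩, hw, hw'⟩, rfl⟩
  have e1 := hWU (hBW y hy b hb).1 (hAW' x hx' x' hz').1 (hBW b hb y' hw).1 h1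
  have e2 := hWU (hAW a ha x' hz).2 (hBW' y hy' y' hw').2 (hAW x hx a ha).2 h1
  constructor
  · convert e1 using 1; group
  · convert e2 using 1; group

end IsTwoSidedCauchy

theorem isTwoSidedCauchy_nhds {X : Type u} [Group X] [TopologicalSpace X]
    [IsTopologicalGroup X] (y : X) : IsTwoSidedCauchy (𝓝 y) := by
  refine ⟨inferInstance, fun V hV => ?_⟩
  have h1 : ∀ᶠ p : X × X in 𝓝 y ×ˢ 𝓝 y, p.1⁻¹ * p.2 ∈ V ∧ p.2 * p.1⁻¹ ∈ V := by
    rw [← nhds_prod_eq]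
    exact (ContinuousAt.eventually_mem (by fun_prop) (by simpa using hV)).and
      (ContinuousAt.eventually_mem (by fun_prop) (by simpa using hV))
  obtain ⟨A, hA, h⟩ := mem_prod_self_iff.1 h1
  exact ⟨A, hA, fun x hx z hz => h (mk_mem_prod hx hz)⟩

theorem twoSidedUniformSpace_toTopologicalSpace (G : Type*) [Group G] [t : TopologicalSpace G]
    [IsTopologicalGroup G] : (twoSidedUniformSpace G).toTopologicalSpace = t := by
  rw [twoSidedUniformSpace, UniformSpace.toTopologicalSpace_inf]
  exact inf_idem t

theorem isCompleteTopGroup_iff {G : Type*} [Group G] [TopologicalSpace G] [IsTopologicalGroup G] :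
    IsCompleteTopGroup G ↔ ∀ F : Filter G, IsTwoSidedCauchy F → ∃ x, F ≤ 𝓝 x := by
  have e := twoSidedUniformSpace_toTopologicalSpace G
  constructor
  · intro h F hF
    obtain ⟨x, hx⟩ := h.complete (IsTwoSidedCauchy.iff_cauchy.1 hF)
    exact ⟨x, by rwa [e] at hx⟩
  · intro h
    refine @CompleteSpace.mk _ (twoSidedUniformSpace G) fun {F} hF => ?_
    obtain ⟨x, hx⟩ := h F (IsTwoSidedCauchy.iff_cauchy.2 hF)
    exact ⟨x, by rwa [e]⟩

/-- The Raikov completion of a topological group, which need not be Hausdorff. -/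
theorem exists_raikov_completion (G : Type u) [Group G] [t : TopologicalSpace G]
    [IsTopologicalGroup G] :
    ∃ (Y : Type u) (_ : Group Y) (_ : TopologicalSpace Y) (_ : IsTopologicalGroup Y)
      (_ : T2Space Y) (f : G →* Y), IsDenseInducing f ∧
        ∀ F : Filter G, IsTwoSidedCauchy F → ∃ y, F.map f ≤ 𝓝 y := by
  have hcauchy := @IsTwoSidedCauchy.iff_cauchy G _ t _
  let us : UniformSpace G := (twoSidedUniformSpace G).replaceTopology
    (twoSidedUniformSpace_toTopologicalSpace G).symm
  replace hcauchy : ∀ F : Filter G, IsTwoSidedCauchy F ↔ Cauchy F := fun F => hcauchy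
  let Y := UniformSpace.Completion G
  let e : G → Y := (↑)
  have de : IsDenseInducing e := UniformSpace.Completion.isDenseInducing_coe
  have lim : ∀ F : Filter G, IsTwoSidedCauchy F → ∃ y, F.map e ≤ 𝓝 y := fun F hF =>
    CompleteSpace.complete (((hcauchy F).1 hF).map
      (UniformSpace.Completion.uniformContinuous_coe G))
  have cau : ∀ y : Y, IsTwoSidedCauchy (comap e (𝓝 y)) := fun y => (hcauchy _).2
    (cauchy_nhds.comap' (UniformSpace.Completion.isUniformInducing_coe G).comap_uniformity.le
      (de.comap_nhds_neBot y))
  have de2 : IsDenseInducing (Prod.map e e) := de.prodMap de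
  -- Multiplication and inversion preserve Cauchy filters, so they extend continuously; the group
  -- axioms pass from the dense image by closedness.
  let m : Y × Y → Y := de2.extend fun p => e (p.1 * p.2)
  have hm : Continuous m := by
    refine de2.continuous_extend ?_
    rintro ⟨y, z⟩
    obtain ⟨w, hw⟩ := lim _ ((cau y).map_mul (cau z))
    refine ⟨w, ?_⟩
    have h : comap (Prod.map e e) (𝓝 (y, z)) = comap e (𝓝 y) ×ˢ comap e (𝓝 z) := by
      rw [nhds_prod_eq, prod_comap_comap_eq]
      rfl
    rw [h]
    exact hw
  have hme : ∀ a b, m (e a, e b) = e (a * b) := fun a b =>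
    de2.extend_eq (f := fun p : G × G => e (p.1 * p.2)) (de.continuous.comp continuous_mul) (a, b)
  let i : Y → Y := de.extend fun p => e p⁻¹
  have hi : Continuous i := by
    refine de.continuous_extend fun y => ?_
    exact lim _ (cau y).map_inv
  have hie : ∀ a, i (e a) = e a⁻¹ := fun a =>
    de.extend_eq (f := fun p : G => e p⁻¹) (de.continuous.comp continuous_inv) a
  let : Mul Y := ⟨fun a b => m (a, b)⟩
  let : Inv Y := ⟨i⟩
  let : One Y := ⟨e 1⟩
  have hmul : Continuous fun p : Y × Y => p.1 * p.2 := hm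
  have hinv : Continuous fun p : Y => p⁻¹ := hi
  have emul : ∀ a b, e a * e b = e (a * b) := hme
  have einv : ∀ a, (e a)⁻¹ = e a⁻¹ := hie
  have : ContinuousMul Y := ⟨hmul⟩
  let : Group Y := Group.ofLeftAxioms
    (fun a b c => UniformSpace.Completion.induction_on₃ a b c
      (isClosed_eq (by fun_prop) (by fun_prop))
      (fun a b c => by
        change e a * e b * e c = e a * (e b * e c)
        simp only [emul, mul_assoc]))
    (fun a => UniformSpace.Completion.induction_on a
      (isClosed_eq (by fun_prop) (by fun_prop))
      (fun a => by
        change e 1 * e a = e a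
        simp only [emul, one_mul]))
    (fun a => UniformSpace.Completion.induction_on a
      (isClosed_eq (by fun_prop) (by fun_prop))
      (fun a => by
        change (e a)⁻¹ * e a = e 1
        simp only [einv, emul, inv_mul_cancel]))
  exact ⟨Y, inferInstance, inferInstance, { continuous_mul := hmul, continuous_inv := hinv },
    inferInstance, { toFun := e, map_one' := rfl, map_mul' := fun a b => (emul a b).symm }, de, lim⟩

/-! ### Completeness of `h:TG`-closed groups, and the converse direction -/

/-- In an `h:TG`-closed group, two-sided Cauchy filters converge for every coarser group topology,
Hausdorff or not. -/
theorem IsHTGClosed.exists_le_nhds {X : Type u} [Group X] [t : TopologicalSpace X]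
    (hX : IsHTGClosed X) {t' : TopologicalSpace X} (ht : t ≤ t') (hg : @IsTopologicalGroup X t' _)
    {F : Filter X} (hF : @IsTwoSidedCauchy X _ t' F) : ∃ x, F ≤ @nhds X t' x := by
  obtain ⟨Y, _, _, _, _, f, hf, hlim⟩ := @exists_raikov_completion X _ t' hg
  have hc : IsClosed (range f) := hX Y f (continuous_le_dom ht (@IsDenseInducing.continuous _ _ t' _ _ hf))
  obtain ⟨y, hy⟩ := hlim F hF
  have hs : range f = univ := by
    rw [← hc.closure_eq]; exact (@IsDenseInducing.dense _ _ t' _ _ hf).closure_eq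
  obtain ⟨x, rfl⟩ : y ∈ range f := hs ▸ mem_univ y
  refine ⟨x, ?_⟩
  rw [@IsDenseInducing.nhds_eq_comap _ _ t' _ _ hf]
  exact map_le_iff_le_comap.1 hy

theorem IsHTGClosed.of_surjective {X Y : Type u} [Group X] [TopologicalSpace X] [Group Y]
    [TopologicalSpace Y] (hX : IsHTGClosed X) (f : X →* Y) (hf : Continuous f)
    (hs : Function.Surjective f) : IsHTGClosed Y := by
  intro Z _ _ _ _ g hg
  have := hX Z (g.comp f) (hg.comp hf)
  rwa [MonoidHom.coe_comp, hs.range_comp] at this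

theorem IsOmegaNarrow.of_surjective {X Y : Type u} [Group X] [TopologicalSpace X] [Group Y]
    [TopologicalSpace Y] (hX : IsOmegaNarrow X) (f : X →* Y) (hf : Continuous f)
    (hs : Function.Surjective f) : IsOmegaNarrow Y := by
  intro U hU
  obtain ⟨C, hC, h⟩ := hX (f ⁻¹' U) (hf.continuousAt.preimage_mem_nhds (by simpa using hU))
  refine ⟨f '' C, hC.image f, eq_univ_of_forall fun y => ?_⟩
  obtain ⟨x, rfl⟩ := hs y
  obtain ⟨c, hc, u, hu, rfl⟩ := Set.mem_mul.1 (h ▸ mem_univ x)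
  exact ⟨f c, mem_image_of_mem f hc, f u, hu, by simp⟩

/-- A topological isomorphism of a complete group onto a subgroup has closed range. -/
theorem IsCompleteTopGroup.isClosed_range {X Y : Type u} [Group X] [TopologicalSpace X]
    [IsTopologicalGroup X] [Group Y] [TopologicalSpace Y] [IsTopologicalGroup Y] [T2Space Y]
    (hX : IsCompleteTopGroup X) (f : X →* Y) (hf : Topology.IsInducing f) :
    IsClosed (range f) := by
  rw [← closure_subset_iff_isClosed]
  intro y hy
  have hne : (comap f (𝓝 y)).NeBot := by
    rw [comap_neBot_iff_frequently]
    exact (mem_closure_iff_frequently.1 hy)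
  have hcau : IsTwoSidedCauchy (comap f (𝓝 y)) := by
    refine ⟨hne, fun U hU => ?_⟩
    rw [hf.nhds_eq_comap, map_one] at hU
    obtain ⟨V, hV, hVU⟩ := hU
    obtain ⟨A, hA, h⟩ := (isTwoSidedCauchy_nhds y).2 V hV
    refine ⟨f ⁻¹' A, preimage_mem_comap hA, fun x hx z hz => ?_⟩
    have := h _ hx _ hz
    exact ⟨hVU (by simpa using this.1), hVU (by simpa using this.2)⟩
  obtain ⟨x, hx⟩ := isCompleteTopGroup_iff.1 hX _ hcau
  refine ⟨x, tendsto_nhds_unique (f := f) (l := comap f (𝓝 y)) ?_ tendsto_comap⟩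
  exact (hf.continuous.tendsto x).mono_left hx

/-- Minimality of X/ker f makes its bijection onto the range of f a topological isomorphism, and a
complete subgroup is closed. -/
theorem IsHTGClosed.of_totally {X : Type u} [Group X] [TopologicalSpace X] [IsTopologicalGroup X]
    (hc : IsTotallyComplete X) (hm : IsTotallyMinimal X) : IsHTGClosed X := by
  intro Y _ _ _ _ f hf
  have hN : IsClosed (f.ker : Set X) := isClosed_singleton.preimage hf
  let g : X ⧸ f.ker →* f.range := QuotientGroup.rangeKerLift f
  have hg : Continuous g := by
    refine (QuotientGroup.isQuotientMap_mk f.ker).continuous_iff.2 ?_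
    exact hf.subtype_mk _
  have hgb : Function.Bijective g :=
    ⟨QuotientGroup.rangeKerLift_injective f, QuotientGroup.rangeKerLift_surjective f⟩
  have ho : IsOpenMap g := hm f.ker hN f.range g hg hgb
  have hi : Topology.IsInducing g := (Topology.IsOpenEmbedding.of_continuous_injective_isOpenMap
    hg hgb.1 ho).isInducing
  have := (hc f.ker hN).isClosed_range (f.range.subtype.comp g)
    (Topology.IsInducing.subtypeVal.comp hi)
  rwa [MonoidHom.coe_comp, hgb.2.range_comp, Subgroup.coe_subtype, Subtype.range_coe] at this

theorem IsHTGClosed.isTotallyComplete {X : Type u} [Group X] [TopologicalSpace X]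
    [IsTopologicalGroup X] (hX : IsHTGClosed X) : IsTotallyComplete X := by
  intro N _ _
  refine isCompleteTopGroup_iff.2 fun _ hF => ?_
  have hg : IsTopologicalGroup (X ⧸ N) := inferInstance
  exact (hX.of_surjective (QuotientGroup.mk' N) continuous_quot_mk
    (QuotientGroup.mk'_surjective N)).exists_le_nhds le_rfl hg hF

/-! ### Coarser group topologies with a countable base at the unit -/

/-- In an ω-narrow group, countably many translates of `A` enumerate a cover. -/
theorem IsOmegaNarrow.exists_seq {X : Type u} [Group X] [TopologicalSpace X]
    (hX : IsOmegaNarrow X) : ∃ c : Set X → ℕ → X, ∀ A ∈ 𝓝 (1 : X), ∀ x, ∃ i, (c A i)⁻¹ * x ∈ A := by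
  have : ∀ A : Set X, ∃ c : ℕ → X, A ∈ 𝓝 (1 : X) → ∀ x, ∃ i, (c i)⁻¹ * x ∈ A := by
    intro A
    by_cases hA : A ∈ 𝓝 (1 : X)
    · obtain ⟨C, hC, h⟩ := hX A hA
      have hne : C.Nonempty := by
        obtain ⟨c, hc, -⟩ := Set.mem_mul.1 (h ▸ mem_univ (1 : X))
        exact ⟨c, hc⟩
      obtain ⟨c, rfl⟩ := hC.exists_eq_range hne
      refine ⟨c, fun _ x => ?_⟩
      obtain ⟨_, ⟨i, rfl⟩, u, hu, rfl⟩ := Set.mem_mul.1 (h ▸ mem_univ x)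
      exact ⟨i, by simpa using hu⟩
    · exact ⟨1, fun h => absurd h hA⟩
  choose c hc using this
  exact ⟨c, hc⟩

/-- In an ω-narrow group, one can choose a sequence of open neighborhoods of the unit which is a
base at the unit of a coarser group topology, together with a sequence of points such that the
translates of the neighborhoods by the points are nested, form a two-sided Cauchy sequence for
this topology, and pass through given dense open sets. -/
theorem IsOmegaNarrow.exists_nested_seq {X : Type u} [Group X] [TopologicalSpace X]
    [IsTopologicalGroup X] (hX : IsOmegaNarrow X) {D : ℕ → Set X} (hDo : ∀ n, IsOpen (D n))
    (hDd : ∀ n, Dense (D n)) (a : X) {U : Set X} (hU : U ∈ 𝓝 (1 : X)) :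
    ∃ (x : ℕ → X) (V : ℕ → Set X), x 0 = a ∧ V 0 ⊆ U ∧ (∀ n, IsOpen (V n)) ∧ (∀ n, 1 ∈ V n) ∧
      (∀ n, V (n + 1) * V (n + 1) ⊆ V n) ∧ (∀ n, (V (n + 1))⁻¹ ⊆ V n) ∧
      (∀ g n, ∃ k, ∀ v ∈ V k, g * v * g⁻¹ ∈ V n) ∧
      (∀ n, ∀ v ∈ V (n + 1), ∀ w ∈ V (n + 1), x (n + 1) * (v * w) ∈ D n ∧
        (x n)⁻¹ * (x (n + 1) * (v * w)) ∈ V n) ∧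
      (∀ n, ∀ v ∈ V (n + 1), ∀ w ∈ V (n + 1), x (n + 1) * (v * w⁻¹) * (x (n + 1))⁻¹ ∈ V n) := by
  obtain ⟨c, hc⟩ := hX.exists_seq
  -- A state holds the point, the current neighborhood and the finite set of all neighborhoods so
  -- far. Stage n makes conjugation by `c A i` map the new neighborhood into A, for all earlier A
  -- and i ≤ n; thus each pair (A, i) is eventually handled.
  let Inv : X × Set X × Set (Set X) → Prop := fun s =>
    IsOpen s.2.1 ∧ 1 ∈ s.2.1 ∧ s.2.2.Finite ∧ (∀ A ∈ s.2.2, A ∈ 𝓝 (1 : X)) ∧ s.2.1 ∈ s.2.2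
  let R : ℕ → X × Set X × Set (Set X) → X × Set X × Set (Set X) → Prop := fun n s s' =>
    s'.2.1 * s'.2.1 ⊆ s.2.1 ∧ s'.2.1⁻¹ ⊆ s.2.1 ∧
    (∀ v ∈ s'.2.1, ∀ w ∈ s'.2.1, s'.1 * (v * w) ∈ D n ∧ s.1⁻¹ * (s'.1 * (v * w)) ∈ s.2.1) ∧
    (∀ v ∈ s'.2.1, ∀ w ∈ s'.2.1, s'.1 * (v * w⁻¹) * s'.1⁻¹ ∈ s.2.1) ∧
    s.2.2 ⊆ s'.2.2 ∧ (∀ A ∈ s.2.2, ∀ i ≤ n, ∀ v ∈ s'.2.1, (c A i)⁻¹ * v * c A i ∈ A)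
  have step : ∀ n (s : {s // Inv s}), ∃ s' : {s // Inv s}, R n s.1 s'.1 := by
    rintro n ⟨⟨x, V, L⟩, hVo, hV1, hLf, hL, hVL⟩
    dsimp only at hVo hV1 hLf hL hVL
    have hVn : V ∈ 𝓝 (1 : X) := hVo.mem_nhds hV1
    obtain ⟨y, hyV, hyD⟩ : ((fun z => x⁻¹ * z) ⁻¹' V ∩ D n).Nonempty :=
      (hDd n).inter_open_nonempty _ (hVo.preimage (by fun_prop)) ⟨x, by simpa using hV1⟩
    -- Products of two factors leave room for a limit that exists only in the coarser topology. The
    -- last condition gives right Cauchyness; it can be imposed because y is chosen before W.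
    have h1 : ∀ᶠ p : X × X in 𝓝 1 ×ˢ 𝓝 1, p.1 * p.2 ∈ V ∧ p.1⁻¹ ∈ V ∧ y * (p.1 * p.2) ∈ D n ∧
        x⁻¹ * (y * (p.1 * p.2)) ∈ V ∧ y * (p.1 * p.2⁻¹) * y⁻¹ ∈ V := by
      rw [← nhds_prod_eq]
      refine .and ?_ <| .and ?_ <| .and ?_ <| .and ?_ ?_
      · exact ContinuousAt.eventually_mem (by fun_prop) (by simpa using hVn)
      · exact ContinuousAt.eventually_mem (by fun_prop) (by simpa using hVn)
      · exact ContinuousAt.eventually_mem (by fun_prop) (by simpa using (hDo n).mem_nhds hyD)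
      · exact ContinuousAt.eventually_mem (by fun_prop) (by simpa using hVo.mem_nhds hyV)
      · exact ContinuousAt.eventually_mem (by fun_prop) (by simpa using hVn)
    obtain ⟨W, hW, hWV⟩ := mem_prod_self_iff.1 h1
    have h2 : ∀ᶠ v in 𝓝 (1 : X), ∀ A ∈ L, ∀ i ∈ Iic n, (c A i)⁻¹ * v * c A i ∈ A := by
      refine (eventually_all_finite hLf).2 fun A hA =>
        (eventually_all_finite (finite_Iic n)).2 fun i _ => ?_
      exact ContinuousAt.eventually_mem (by fun_prop) (by simpa using hL A hA)
    obtain ⟨V', hV', hV'o, hV'1⟩ := mem_nhds_iff.1 (inter_mem hW h2)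
    refine ⟨⟨(y, V', insert V' L), hV'o, hV'1, hLf.insert _, ?_, mem_insert _ _⟩, ?_, ?_, ?_, ?_,
      subset_insert _ _, ?_⟩
    · rintro A (rfl | hA)
      exacts [hV'o.mem_nhds hV'1, hL A hA]
    · rintro _ ⟨v, hv, w, hw, rfl⟩
      exact (hWV (mk_mem_prod (hV' hv).1 (hV' hw).1)).1
    · intro v hv
      simpa using (hWV (mk_mem_prod (hV' hv).1 (hV' hv).1)).2.1
    · exact fun v hv w hw => ⟨(hWV (mk_mem_prod (hV' hv).1 (hV' hw).1)).2.2.1,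
        (hWV (mk_mem_prod (hV' hv).1 (hV' hw).1)).2.2.2.1⟩
    · exact fun v hv w hw => (hWV (mk_mem_prod (hV' hv).1 (hV' hw).1)).2.2.2.2
    · exact fun A hA i hi v hv => (hV' hv).2 A hA i hi
  choose next hnext using step
  obtain ⟨V₀, hV₀U, hV₀o, hV₀1⟩ := mem_nhds_iff.1 hU
  let S : ℕ → {s // Inv s} := fun n => Nat.rec ⟨(a, V₀, {V₀}), hV₀o, hV₀1, finite_singleton _,
    by rintro A rfl; exact hV₀o.mem_nhds hV₀1, mem_singleton _⟩ (fun n s => next n s) n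
  have hS : ∀ n, R n (S n).1 (S (n + 1)).1 := fun n => hnext n (S n)
  have hmono : Monotone fun n => (S n).1.2.2 := monotone_nat_of_le_succ fun n => (hS n).2.2.2.2.1
  have hmul : ∀ n, (S (n + 1)).1.2.1 * (S (n + 1)).1.2.1 ⊆ (S n).1.2.1 := fun n => (hS n).1
  have hinv : ∀ n, (S (n + 1)).1.2.1⁻¹ ⊆ (S n).1.2.1 := fun n => (hS n).2.1
  refine ⟨fun n => (S n).1.1, fun n => (S n).1.2.1, rfl, hV₀U, fun n => (S n).2.1,
    fun n => (S n).2.2.1, hmul, hinv, fun g m => ?_, fun n => (hS n).2.2.1,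
    fun n => (hS n).2.2.2.1⟩
  have hA := (S (m + 2)).2
  -- With g⁻¹ = cu and u ∈ V (m + 2), gvg⁻¹ = u⁻¹(c⁻¹vc)u, so countably many conjugations suffice.
  obtain ⟨i, hi⟩ := hc _ (hA.2.2.2.1 _ hA.2.2.2.2) g⁻¹
  refine ⟨max (m + 2) i + 1, fun v hv => ?_⟩
  have h3 := (hS (max (m + 2) i)).2.2.2.2.2 _ (hmono (le_max_left _ _) hA.2.2.2.2) i
    (le_max_right _ _) v hv
  have h4 := hmul (m + 1) (mul_mem_mul h3 hi)
  have h5 := hinv (m + 1) (Set.inv_mem_inv.2 hi)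
  convert hmul m (mul_mem_mul h5 h4) using 1
  group

/-- A sequence of sets as in `IsOmegaNarrow.exists_nested_seq` is a base of a group topology. -/
theorem exists_groupTopology_of_seq {X : Type u} [Group X] [t : TopologicalSpace X]
    [IsTopologicalGroup X] {V : ℕ → Set X} (hVo : ∀ n, IsOpen (V n)) (hV1 : ∀ n, 1 ∈ V n)
    (hmul : ∀ n, V (n + 1) * V (n + 1) ⊆ V n) (hinv : ∀ n, (V (n + 1))⁻¹ ⊆ V n)
    (hconj : ∀ g n, ∃ k, ∀ v ∈ V k, g * v * g⁻¹ ∈ V n) :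
    Antitone V ∧ ∃ t' : TopologicalSpace X, t ≤ t' ∧ @IsTopologicalGroup X t' _ ∧
      (@nhds X t' 1).HasBasis (fun _ => True) V := by
  have hanti : Antitone V := antitone_nat_of_succ_le fun n x hx =>
    hmul n ⟨x, hx, 1, hV1 _, mul_one x⟩
  refine ⟨hanti, ?_⟩
  let B : GroupFilterBasis X :=
    { sets := range V
      nonempty := range_nonempty V
      inter_sets := by
        rintro _ _ ⟨m, rfl⟩ ⟨n, rfl⟩
        exact ⟨V (max m n), mem_range_self _,
          subset_inter (hanti (le_max_left _ _)) (hanti (le_max_right _ _))⟩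
      one' := by rintro _ ⟨n, rfl⟩; exact hV1 n
      mul' := by rintro _ ⟨n, rfl⟩; exact ⟨V (n + 1), mem_range_self _, hmul n⟩
      inv' := by
        rintro _ ⟨n, rfl⟩
        exact ⟨V (n + 1), mem_range_self _, fun x hx => hinv n (Set.inv_mem_inv.2 hx)⟩
      conj' := by
        rintro g _ ⟨n, rfl⟩
        obtain ⟨k, hk⟩ := hconj g n
        exact ⟨V k, mem_range_self _, hk⟩ }
  have hb : (@nhds X B.topology 1).HasBasis (fun _ => True) V :=
    B.nhds_one_hasBasis.to_hasBasis (by rintro _ ⟨n, rfl⟩; exact ⟨n, trivial, Subset.rfl⟩)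
      (fun n _ => ⟨V n, mem_range_self n, Subset.rfl⟩)
  refine ⟨B.topology, ?_, B.isTopologicalGroup, hb⟩
  have h1 : 𝓝 (1 : X) ≤ @nhds X B.topology 1 :=
    hb.ge_iff.2 fun n _ => (hVo n).mem_nhds (hV1 n)
  refine le_of_nhds_le_nhds fun x => ?_
  rw [← @nhds_translation_mul_inv X t _ _ x, ← @nhds_translation_mul_inv X B.topology _ _ x]
  exact comap_mono h1

/-! ### The Baire property -/

theorem preimage_inv_mul_mem_nhds {X : Type u} [Group X] [TopologicalSpace X]
    [IsTopologicalGroup X] {V : Set X} (hV : V ∈ 𝓝 (1 : X)) (y : X) :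
    (fun z => z⁻¹ * y) ⁻¹' V ∈ 𝓝 y :=
  ContinuousAt.preimage_mem_nhds (by fun_prop) (by simpa using hV)

theorem IsHTGClosed.baireSpace {X : Type u} [Group X] [t : TopologicalSpace X]
    [IsTopologicalGroup X] (hX : IsHTGClosed X) (hn : IsOmegaNarrow X) : BaireSpace X := by
  refine ⟨fun D hDo hDd => dense_iff_inter_open.2 fun O hO => ?_⟩
  rintro ⟨a, ha⟩
  have hU : (fun x => a * x) ⁻¹' O ∈ 𝓝 (1 : X) :=
    (hO.preimage (continuous_const_mul a)).mem_nhds (by simpa using ha)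
  obtain ⟨x, V, rfl, hV0, hVo, hV1, hmul, hinv, hconj, hnest, hright⟩ :=
    hn.exists_nested_seq hDo hDd a hU
  obtain ⟨hanti, t', ht, hg, hb⟩ := exists_groupTopology_of_seq hVo hV1 hmul hinv hconj
  let W : ℕ → Set X := fun n => {y | (x n)⁻¹ * y ∈ V n}
  have hW : Antitone W := antitone_nat_of_succ_le fun n y hy => by
    have := (hnest n _ hy 1 (hV1 _)).2
    simpa [W] using this
  have hWne : ∀ n, x n ∈ W n := fun n => by simpa [W] using hV1 n
  have hbas : (⨅ n, 𝓟 (W n)).HasBasis (fun _ => True) W := hasBasis_iInf_principal hW.directed_ge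
  have hcau : @IsTwoSidedCauchy X _ t' (⨅ n, 𝓟 (W n)) := by
    refine ⟨hbas.neBot_iff.2 fun {n} _ => ⟨_, hWne n⟩, fun U hU => ?_⟩
    obtain ⟨n, -, hn⟩ := hb.mem_iff.1 hU
    refine ⟨W (n + 2), hbas.mem_of_mem trivial, fun y hy z hz => ⟨hn ?_, hn ?_⟩⟩
    · convert hmul n (mul_mem_mul (hinv _ (Set.inv_mem_inv.2 hy)) (hanti (Nat.le_succ _) hz)) using 1
      group
    · convert hanti (Nat.le_succ n) (hright (n + 1) _ hz _ hy) using 1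
      group
  obtain ⟨y, hy⟩ := hX.exists_le_nhds (t := t) ht hg hcau
  -- For large k, y = x n · (x n)⁻¹(x k) · (x k)⁻¹y: the second factor is in V n by nesting, the
  -- third by convergence.
  have hlim : ∀ n, ∃ v ∈ V n, ∃ w ∈ V n, y = x n * (v * w) := by
    intro n
    have hV' : (fun z => z⁻¹ * y) ⁻¹' V n ∈ @nhds X t' y :=
      @preimage_inv_mul_mem_nhds X _ t' hg _ (hb.mem_of_mem trivial) y
    obtain ⟨m, -, hm⟩ := hbas.mem_iff.1 (hy hV')
    have h1 : x (max m n) ∈ W n := hW (le_max_right _ _) (hWne _)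
    have h2 := hm (hW (le_max_left m n) (hWne _))
    exact ⟨_, h1, _, h2, by group⟩
  refine ⟨y, ?_, mem_iInter.2 fun n => ?_⟩
  · obtain ⟨v, hv, w, hw, rfl⟩ := hlim 1
    have := hV0 (hnest 0 v hv w hw).2
    simpa using this
  · obtain ⟨v, hv, w, hw, rfl⟩ := hlim (n + 1)
    exact (hnest n v hv w hw).1

/-! ### Almost openness and minimality -/

section AlmostOpen

variable {X Y : Type u} [Group X] [tX : TopologicalSpace X] [IsTopologicalGroup X] [Group Y]
  [TopologicalSpace Y] [IsTopologicalGroup Y]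

/-- Countably many translates of f(W) cover the Baire group Y, so the closure of one has interior;
translating back by a point of it lands in the closure of f(W⁻¹W). -/
theorem IsOmegaNarrow.closure_image_mem_nhds [BaireSpace Y] (hX : IsOmegaNarrow X) {f : X →* Y}
    (hs : Surjective f) {V : Set X} (hV : V ∈ 𝓝 (1 : X)) : closure (f '' V) ∈ 𝓝 (1 : Y) := by
  obtain ⟨W, hW, hWV⟩ := (isTwoSidedCauchy_nhds (1 : X)).2 V hV
  obtain ⟨c, hc⟩ := hX.exists_seq
  have hcov : ⋃ i, closure ((fun x => f (c W i * x)) '' W) = univ := by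
    refine eq_univ_of_forall fun y => ?_
    obtain ⟨x, rfl⟩ := hs y
    obtain ⟨i, hi⟩ := hc W hW x
    exact mem_iUnion.2 ⟨i, subset_closure ⟨_, hi, by simp⟩⟩
  obtain ⟨i, y, hy⟩ := nonempty_interior_of_iUnion_of_closed (fun _ => isClosed_closure) hcov
  obtain ⟨_, hz, w, hw, rfl⟩ :=
    mem_closure_iff.1 (interior_subset hy) _ isOpen_interior hy
  have hn : (fun y => f (c W i * w) * y) ⁻¹' interior (closure ((fun x => f (c W i * x)) '' W)) ∈
      𝓝 (1 : Y) :=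
    (isOpen_interior.preimage (continuous_const_mul _)).mem_nhds (by simpa using hz)
  filter_upwards [hn] with y hy
  have := map_mem_closure (continuous_const_mul (f (c W i * w))⁻¹) (interior_subset hy)
    (t := f '' V) ?_
  · simpa [mul_assoc] using this
  · rintro _ ⟨x, hx, rfl⟩
    exact ⟨w⁻¹ * x, (hWV w hw x hx).1, by simp [mul_assoc]⟩

theorem IsOmegaNarrow.image_subset_interior_closure [BaireSpace Y] (hX : IsOmegaNarrow X)
    {f : X →* Y} (hs : Surjective f) {A : Set X} (hA : IsOpen A) :
    f '' A ⊆ interior (closure (f '' A)) := by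
  rintro _ ⟨a, ha, rfl⟩
  have h1 : (fun x => a * x) ⁻¹' A ∈ 𝓝 (1 : X) :=
    (hA.preimage (continuous_const_mul a)).mem_nhds (by simpa using ha)
  have h2 : (fun y => (f a)⁻¹ * y) ⁻¹' closure (f '' ((fun x => a * x) ⁻¹' A)) ∈ 𝓝 (f a) :=
    ContinuousAt.preimage_mem_nhds (by fun_prop)
      (by simpa using hX.closure_image_mem_nhds hs h1)
  rw [mem_interior_iff_mem_nhds]
  filter_upwards [h2] with y hy
  have := map_mem_closure (continuous_const_mul (f a)) hy (t := f '' A) ?_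
  · simpa using this
  · rintro _ ⟨x, hx, rfl⟩
    exact ⟨a * x, hx, by simp⟩

/-- The image of a neighborhood of the unit contains a comeager subset of an open neighborhood
of the unit. -/
theorem IsHTGClosed.exists_dense_open [BaireSpace Y] [T2Space Y] (hc : IsHTGClosed X)
    (hX : IsOmegaNarrow X) {f : X →* Y} (hf : Continuous f) (hb : Bijective f) {U : Set X}
    (hU : U ∈ 𝓝 (1 : X)) :
    ∃ (E : List (ℕ × ℕ) → Set Y) (T : Set Y), (∀ l, IsOpen (E l)) ∧ (∀ l, Dense (E l)) ∧
      IsOpen T ∧ 1 ∈ T ∧ ∀ w ∈ T, (∀ l, w ∈ E l) → w ∈ f '' U := by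
  obtain ⟨-, V, -, hV0, hVo, hV1, hmul, hinv, hconj, -, -⟩ :=
    hX.exists_nested_seq (D := fun _ => univ) (fun _ => isOpen_univ) (fun _ => dense_univ) 1 hU
  obtain ⟨c, hcov⟩ := hX.exists_seq
  -- Controlling both x and x⁻¹ makes these sets small on both sides.
  let P : ℕ → ℕ × ℕ → Set X := fun n p =>
    {x | (c (V n) p.1)⁻¹ * x ∈ V n ∧ (c (V n) p.2)⁻¹ * x⁻¹ ∈ V n}
  obtain ⟨O, hOnil, hOcons⟩ : ∃ O : List (ℕ × ℕ) → Set X,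
      -- Starting at V 1 puts the limit in V 1 · V 1 ⊆ V 0 ⊆ U.
      O [] = V 1 ∧ ∀ p l, O (p :: l) = O l ∩ P l.length p :=
    ⟨fun l => List.rec (V 1) (fun p l A => A ∩ P l.length p) l, rfl, fun _ _ => rfl⟩
  have hPo : ∀ n p, IsOpen (P n p) := fun n p =>
    ((hVo n).preimage (by fun_prop)).inter ((hVo n).preimage (by fun_prop))
  have hOo : ∀ l, IsOpen (O l) := fun l => by
    induction l with
    | nil => exact hOnil ▸ hVo 1
    | cons p l ih => exact hOcons p l ▸ ih.inter (hPo _ _)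
  let I : List (ℕ × ℕ) → Set Y := fun l => interior (closure (f '' O l))
  have hI : ∀ l, f '' O l ⊆ I l := fun l => hX.image_subset_interior_closure hb.2 (hOo l)
  -- A point of I l lying in this set lies in some I (p :: l), so the branch continues; the
  -- complement of the closure only ensures density.
  refine ⟨fun l => (⋃ p, I (p :: l)) ∪ (closure (f '' O l))ᶜ, I [], fun l => ?_, fun l => ?_,
    isOpen_interior, hI [] ⟨1, hOnil ▸ hV1 1, map_one f⟩, fun w hw hE => ?_⟩
  · exact (isOpen_iUnion fun _ => isOpen_interior).union isClosed_closure.isOpen_compl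
  · have h1 : f '' O l ⊆ ⋃ p, I (p :: l) := by
      rintro _ ⟨x, hx, rfl⟩
      have hVn := (hVo l.length).mem_nhds (hV1 _)
      obtain ⟨i, hi⟩ := hcov _ hVn x
      obtain ⟨j, hj⟩ := hcov _ hVn x⁻¹
      exact mem_iUnion.2 ⟨(i, j), hI _ ⟨x, hOcons _ l ▸ ⟨hx, hi, hj⟩, rfl⟩⟩
    intro y
    by_cases hy : y ∈ closure (f '' O l)
    · exact closure_mono (h1.trans subset_union_left) hy
    · exact subset_closure (Or.inr hy)
  have step : ∀ l : {l // w ∈ I l}, ∃ p, w ∈ I (p :: l.1) := by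
    rintro ⟨l, hl⟩
    rcases hE l with h | h
    · exact mem_iUnion.1 h
    · exact absurd (interior_subset hl) h
  choose next hnext using step
  let S : ℕ → {l // w ∈ I l} := fun n => Nat.rec ⟨[], hw⟩ (fun _ s => ⟨next s :: s.1, hnext s⟩) n
  have hS : ∀ n, (S (n + 1)).1 = next (S n) :: (S n).1 := fun _ => rfl
  have hlen : ∀ n, (S n).1.length = n := fun n => by
    induction n with
    | zero => rfl
    | succ n ih => rw [hS, List.length_cons, ih]
  have hOanti : Antitone fun n => O (S n).1 := antitone_nat_of_succ_le fun n => by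
    rw [hS, hOcons]
    exact inter_subset_left
  have hOP : ∀ n, ∃ p, O (S (n + 1)).1 ⊆ P n p := fun n => ⟨next (S n), by
    rw [hS, hOcons, hlen]
    exact inter_subset_right⟩
  obtain ⟨hanti, t', ht, hg, hbas⟩ := exists_groupTopology_of_seq hVo hV1 hmul hinv hconj
  have hbasO : (⨅ n, 𝓟 (O (S n).1)).HasBasis (fun _ => True) fun n => O (S n).1 :=
    hasBasis_iInf_principal hOanti.directed_ge
  let F : Filter X := (⨅ n, 𝓟 (O (S n).1)) ⊓ comap f (𝓝 w)
  have hFO : ∀ n, O (S n).1 ∈ F := fun n => mem_inf_of_left (hbasO.mem_of_mem trivial)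
  have hFw : ∀ N ∈ 𝓝 w, f ⁻¹' N ∈ F := fun N hN => mem_inf_of_right (preimage_mem_comap hN)
  have hFne : F.NeBot := by
    refine (hbasO.inf ((𝓝 w).basis_sets.comap f)).neBot_iff.2 ?_
    rintro ⟨n, N⟩ ⟨-, hN⟩
    obtain ⟨_, hy, x, hx, rfl⟩ := mem_closure_iff_nhds.1 (interior_subset (S n).2) N hN
    exact ⟨x, hx, hy⟩
  -- This topology is still coarser than that of X. Along F, the branch gives smallness for `t'` and
  -- convergence to w gives it for the induced part.
  let t'' : TopologicalSpace X := t' ⊓ TopologicalSpace.induced f inferInstance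
  have hg'' : @IsTopologicalGroup X t'' _ := topologicalGroup_inf hg (topologicalGroup_induced f)
  have hnhds : ∀ x, @nhds X t'' x = @nhds X t' x ⊓ comap f (𝓝 (f x)) := fun x =>
    (@nhds_inf X t' _ x).trans (congrArg _ (nhds_induced f x))
  have hFc : @IsTwoSidedCauchy X _ t'' F := by
    refine ⟨hFne, fun A hA => ?_⟩
    rw [hnhds, map_one] at hA
    obtain ⟨⟨n, N⟩, ⟨-, hN⟩, hA⟩ := (hbas.inf ((𝓝 (1 : Y)).basis_sets.comap f)).mem_iff.1 hA
    obtain ⟨M, hM, hMN⟩ := (isTwoSidedCauchy_nhds w).2 N hN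
    obtain ⟨p, hp⟩ := hOP (n + 2)
    refine ⟨_, inter_mem (hFO (n + 3)) (hFw M hM), ?_⟩
    rintro x ⟨hx, hxM⟩ z ⟨hz, hzM⟩
    have hx' := hp hx
    have hz' := hp hz
    have := hMN _ hxM _ hzM
    refine ⟨hA ⟨?_, by simpa using this.1⟩, hA ⟨?_, by simpa using this.2⟩⟩
    · convert hmul n (mul_mem_mul (hinv _ (Set.inv_mem_inv.2 hx'.1))
        (hanti (Nat.le_succ _) hz'.1)) using 1
      group
    · convert hmul n (mul_mem_mul (hinv _ (Set.inv_mem_inv.2 hz'.2))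
        (hanti (Nat.le_succ _) hx'.2)) using 1
      group
  obtain ⟨x, hx⟩ := hc.exists_le_nhds (t := tX) (le_inf ht (continuous_iff_le_induced.1 hf)) hg'' hFc
  rw [hnhds] at hx
  have hxw : f x = w := tendsto_nhds_unique (f := f) (l := F)
    (tendsto_iff_comap.2 (hx.trans inf_le_right)) (tendsto_iff_comap.2 inf_le_right)
  refine ⟨x, hV0 ?_, hxw⟩
  have h1 : (fun z => z⁻¹ * x) ⁻¹' V 1 ∈ F :=
    hx (mem_inf_of_left (@preimage_inv_mul_mem_nhds X _ t' hg _ (hbas.mem_of_mem trivial) x))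
  obtain ⟨z, hz, hz'⟩ := hFne.nonempty_of_mem (inter_mem h1 (hFO 0))
  replace hz' : z ∈ V 1 := hOnil ▸ hz'
  convert hmul 0 (mul_mem_mul hz' hz) using 1
  simp

end AlmostOpen

theorem IsHTGClosed.isMinimalTopGroup {X : Type u} [Group X] [TopologicalSpace X]
    [IsTopologicalGroup X] (hc : IsHTGClosed X) (hX : IsOmegaNarrow X) : IsMinimalTopGroup X := by
  intro Y _ _ _ _ f hf hb
  have : BaireSpace Y := (hc.of_surjective f hf hb.2).baireSpace (hX.of_surjective f hf hb.2)
  refine IsTopologicalGroup.isOpenMap_iff_nhds_one.2 fun A hA => ?_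
  have hA' : f ⁻¹' A ∈ 𝓝 (1 : X) := hA
  obtain ⟨U, hU, hUA⟩ := (isTwoSidedCauchy_nhds (1 : X)).2 _ hA'
  obtain ⟨E, T, hEo, hEd, hTo, hT1, hE⟩ := hc.exists_dense_open hX hf hb hU
  filter_upwards [hTo.mem_nhds hT1] with y hy
  let h := Homeomorph.mulLeft y⁻¹
  -- Pettis' argument: a generic w in T with y⁻¹w also in T gives w = f(u) and y⁻¹w = f(v) with u, v
  -- ∈ U, so y = f(uv⁻¹) ∈ A.
  have hd : Dense (⋂ l, E l ∩ h ⁻¹' E l) := dense_iInter_of_isOpen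
    (fun l => (hEo l).inter ((hEo l).preimage h.continuous))
    (fun l => (hEd l).inter_of_isOpen_left ((hEd l).preimage h.isOpenMap) (hEo l))
  obtain ⟨w, ⟨hw, hw'⟩, hwE⟩ := hd.inter_open_nonempty _
    (hTo.inter (hTo.preimage h.continuous)) ⟨y, hy, by simpa [h] using hT1⟩
  rw [mem_iInter] at hwE
  obtain ⟨u, hu, huw⟩ := hE w hw fun l => (hwE l).1
  obtain ⟨v, hv, hvw⟩ := hE _ hw' fun l => (hwE l).2
  have := (hUA v hv u hu).2
  simpa [huw, hvw, h] using this

/-- A Hausdorff ω-narrow topological group is `h:TG`-closed if and only if it is totally complete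
and totally minimal; moreover, if it is `h:TG`-closed, then it is minimal. -/
theorem theorem6p5 (X : Type u) [Group X] [TopologicalSpace X] [IsTopologicalGroup X] [T2Space X]
    (hX : IsOmegaNarrow X) :
    (IsHTGClosed X ↔ IsTotallyComplete X ∧ IsTotallyMinimal X) ∧
      (IsHTGClosed X → IsMinimalTopGroup X) := by
  refine ⟨⟨fun h => ⟨h.isTotallyComplete, ?_⟩, fun h => .of_totally h.1 h.2⟩,
    fun h => h.isMinimalTopGroup hX⟩
  intro N _ _
  have hs := QuotientGroup.mk'_surjective N
  have hq : IsHTGClosed (X ⧸ N) := h.of_surjective (QuotientGroup.mk' N) continuous_quot_mk hs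
  have hn : IsOmegaNarrow (X ⧸ N) := hX.of_surjective (QuotientGroup.mk' N) continuous_quot_mk hs
  exact hq.isMinimalTopGroup hn
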